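/- For a semigroup $S$, a (right) $S$-module is an abelian group $A$ with a multiplication $A\times S\to A$ such that $(a+b)s=as+bs$ and $(as)t=a(st)$ for all $a,b\in A$, $s,t\in S$. The homology groups $H_n(S,A)$ are the homology groups of the complex $$\cdots\xrightarrow{\partial_3} C_2(S,A)\xrightarrow{\partial_2} C_1(S,A)\xrightarrow{\partial_1} C_0(S,A)=A,$$ where $C_n(S,A)$ is the group of finite sums $\sum a_{s_1,\dots,s_n}[s_1,\dots,s_n]$ over $n$-tuples of elements of $S$ with coefficients in $A$, and $$\partial_n(a[s_1,\dots,s_n])=as_1[s_2,\dots,s_n]+\sum_{i=1}^{n-1}(-1)^i a[s_1,\dots,s_is_{i+1},\dots,s_n]+(-1)^n a[s_1,\dots,s_{n-1}]$$ for $n\ge 2$, $\partial_1(a[s])=as-a$. **Proposition.** Let $S=\prod^{*}_{\lambda\in\Lambda}S_\lambda$ be the free product (the coproduct in the category of semigroups) of an arbitrary family of semigroups $S_\lambda$. Then for every $S$-module $A$ and every $n>1$ $$H_n(S,A)\cong\bigoplus_{\lambda\in\Lambda}H_n(S_\lambda,A)$$ as abelian groups, where $A$ is regarded as an $S_\lambda$-module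 through the canonical homomorphism $S_\lambda\to S$. -/

import Mathlib

/-- A right module over a semigroup `S`: an abelian group `A` with a multiplication
`A × S → A` that is additive in `A` and satisfies `(a s) t = a (s t)`. -/
structure SemigroupModule (S : Type*) [Semigroup S] (A : Type*) [AddCommGroup A] where
  act : A → S → A
  add_act : ∀ (a b : A) (s : S), act (a + b) s = act a s + act b s
  act_mul : ∀ (a : A) (s t : S), act a (s * t) = act (act a s) t

namespace SemigroupModule

variable {S T A : Type*} [Semigroup S] [Semigroup T] [AddCommGroup A]

/-- Restriction of scalars along a semigroup homomorphism `f : T → S`: `a t = a f(t)`. -/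
def restrict (M : SemigroupModule S A) (f : T →ₙ* S) : SemigroupModule T A where
  act a t := M.act a (f t)
  add_act a b t := M.add_act a b (f t)
  act_mul a s t := by rw [map_mul, M.act_mul]

/-- The endomorphism `a ↦ a s` of the abelian group `A`. -/
def actHom (M : SemigroupModule S A) (s : S) : A →+ A :=
  AddMonoidHom.mk' (fun a => M.act a s) fun a b => M.add_act a b s

/-- The group of `n`-chains: finite sums `∑ a [s₁, …, sₙ]` with coefficients `a` in `A`.
For `n = 0` there is only the empty tuple, and this is a copy of `A`. -/
abbrev Chains (_M : SemigroupModule S A) (n : ℕ) : Type _ := (Fin n → S) →₀ A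

/-- The boundary homomorphism from `(n + 1)`-chains to `n`-chains,
`∂(a[s₁, …, sₙ₊₁]) = a s₁ [s₂, …, sₙ₊₁] + ∑_{i=1}^{n} (-1)^i a [s₁, …, sᵢ sᵢ₊₁, …, sₙ₊₁]`
`+ (-1)^(n+1) a [s₁, …, sₙ]`.
Here `Fin.contractNth j (· * ·) s` multiplies the entries of `s` at the (zero-based) positions
`j` and `j + 1` if `j < n`, and it deletes the last entry of `s` if `j = n`. -/
noncomputable def boundary (M : SemigroupModule S A) (n : ℕ) :
    M.Chains (n + 1) →+ M.Chains n :=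
  Finsupp.liftAddHom fun s : Fin (n + 1) → S =>
    (Finsupp.singleAddHom fun i : Fin n => s i.succ).comp (M.actHom (s 0)) +
      ∑ j : Fin (n + 1),
        (-1 : ℤ) ^ ((j : ℕ) + 1) •
          (Finsupp.singleAddHom (Fin.contractNth j (· * ·) s) : A →+ M.Chains n)

/-- The group of `n`-cycles: the kernel of the boundary map, and all chains if `n = 0`. -/
noncomputable def cycles (M : SemigroupModule S A) : (n : ℕ) → AddSubgroup (M.Chains n)
  | 0 => ⊤
  | n + 1 => (M.boundary n).ker

/-- The Eilenberg–MacLane homology group `Hₙ(S, A)`: cycles modulo boundaries. -/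
abbrev Homology (M : SemigroupModule S A) (n : ℕ) : Type _ :=
  M.cycles n ⧸ (M.boundary n).range.addSubgroupOf (M.cycles n)

end SemigroupModule

namespace SemigroupFreeProduct

variable {Λ : Type*} (S : Λ → Type*) [∀ l, Semigroup (S l)]

/-- The defining relations of the free product: the product of two letters from the same factor
is identified with the single letter that is their product in this factor. -/
inductive Rel : FreeSemigroup (Σ l, S l) → FreeSemigroup (Σ l, S l) → Prop
  | mul (l : Λ) (s t : S l) :
      Rel (FreeSemigroup.of ⟨l, s⟩ * FreeSemigroup.of ⟨l, t⟩) (FreeSemigroup.of ⟨l, s * t⟩)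

end SemigroupFreeProduct

/-- The free product (coproduct in the category of semigroups) of a family of semigroups: the
free semigroup on their disjoint union modulo the congruence generated by the multiplication
tables of the factors. -/
abbrev SemigroupFreeProduct {Λ : Type*} (S : Λ → Type*) [∀ l, Semigroup (S l)] : Type _ :=
  (conGen (SemigroupFreeProduct.Rel S)).Quotient

namespace SemigroupFreeProduct

variable {Λ : Type*} (S : Λ → Type*) [∀ l, Semigroup (S l)]

/-- The canonical homomorphism from a factor to the free product. -/
def incl (l : Λ) : S l →ₙ* SemigroupFreeProduct S where
  toFun s := ((FreeSemigroup.of ⟨l, s⟩ : FreeSemigroup (Σ l, S l)) : SemigroupFreeProduct S)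
  map_mul' s t := ((Con.eq _).2 (ConGen.Rel.of _ _ (Rel.mul l s t))).symm

end SemigroupFreeProduct

/-! Write `R = ℤ[S¹]`, where `S¹` is `S` with a unit adjoined. Chains with coefficients in `R` form
free left `R`-modules, and `A ⊗_R -` turns them into chains with coefficients in `A`. It is
therefore enough to compare, over `R`, the complex of `S` with the direct sum of the complexes of
the `S_λ`.

Over `R` both complexes are exact in positive degrees. The reason is an explicit contraction
(`boundary_prepend_component`), available because `S¹` is a free right set over `S¹` itself and over
every `S_λ¹`: cutting off a last syllable in `S_λ` gives a unique factorization `x = y t`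
(`decompose`).

Cut both complexes off below degree one. They become free resolutions of the same left ideal,
generated by the elements `s - 1`. On the factor side, the statement that the relations come from
the boundaries of the `[s, t]` is the universal property of the free product applied to crossed
homomorphisms (`exists_crossedHom`, `ker_augmentation_le`). The comparison theorem gives a homotopy
equivalence from degree one on, and `baseChange` carries it to `A`. The truncation alters homology
in degree one, so isomorphisms result for `n ≥ 2`. -/

namespace SemigroupModule

/-! ### Boundary formulas and change of coefficients. -/

section Naturality

variable {T A A' : Type*} [Semigroup T] [AddCommGroup A] [AddCommGroup A']

theorem boundary_single (M : SemigroupModule T A) (n : ℕ) (s : Fin (n + 1) → T) (a : A) :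
    M.boundary n (Finsupp.single s a) =
      Finsupp.single (fun i : Fin n => s i.succ) (M.act a (s 0)) +
        ∑ j : Fin (n + 1), (-1 : ℤ) ^ ((j : ℕ) + 1) •
          Finsupp.single (Fin.contractNth j (· * ·) s) a := by
  rw [boundary, Finsupp.liftAddHom_apply_single]
  simp [actHom, AddMonoidHom.finsetSum_apply]

/-- The boundary is natural in the coefficients. -/
theorem boundary_mapRange {M : SemigroupModule T A} {M' : SemigroupModule T A'} (φ : A →+ A')
    (hφ : ∀ a s, φ (M.act a s) = M'.act (φ a) s) (n : ℕ) (c : M.Chains (n + 1)) :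
    M'.boundary n (Finsupp.mapRange.addMonoidHom φ c) =
      Finsupp.mapRange.addMonoidHom φ (M.boundary n c) := by
  induction c using Finsupp.induction_linear with
  | zero => simp
  | add f g hf hg => simp only [map_add, hf, hg]
  | single s a =>
    simp only [Finsupp.mapRange.addMonoidHom_apply, Finsupp.mapRange_single]
    simp only [boundary_single, ← Finsupp.mapRange.addMonoidHom_apply, map_add, map_sum, map_zsmul]
    simp [Finsupp.mapRange_single, hφ]

theorem cons_contractNth {n : ℕ} (t : T) (s : Fin (n + 1) → T) (j : Fin (n + 1)) :
    Fin.contractNth j.succ (· * ·) (Fin.cons t s : Fin (n + 2) → T) =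
      Fin.cons t (Fin.contractNth j (· * ·) s) := by
  funext k
  refine Fin.cases ?_ (fun k => ?_) k
  · rw [Fin.contractNth_apply_of_lt _ _ _ _ (by simp)]
    simp
  · rcases lt_trichotomy (k : ℕ) j with h | h | h
    · rw [Fin.contractNth_apply_of_lt _ _ _ _ (by simpa using h), Fin.cons_succ,
        Fin.contractNth_apply_of_lt _ _ _ _ h, ← Fin.succ_castSucc, Fin.cons_succ]
    · rw [Fin.contractNth_apply_of_eq _ _ _ _ (by simpa using h), ← Fin.succ_castSucc]
      simp only [Fin.cons_succ]
      rw [Fin.contractNth_apply_of_eq _ _ _ _ h]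
    · rw [Fin.contractNth_apply_of_gt _ _ _ _ (by simpa using h)]
      simp only [Fin.cons_succ]
      rw [Fin.contractNth_apply_of_gt _ _ _ _ h]

theorem cons_contractNth_zero {n : ℕ} (t : T) (s : Fin (n + 1) → T) :
    Fin.contractNth 0 (· * ·) (Fin.cons t s : Fin (n + 2) → T) =
      Fin.cons (t * s 0) (fun i : Fin n => s i.succ) := by
  funext k
  refine Fin.cases ?_ (fun k => ?_) k
  · rw [Fin.contractNth_apply_of_eq _ _ _ _ (by simp)]
    simp
  · rw [Fin.contractNth_apply_of_gt _ _ _ _ (by simp)]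
    simp

/-- Apart from the first two faces, prepending `t` commutes with the faces of `s` up to sign; this
drives the contraction. -/
theorem boundary_single_cons (M : SemigroupModule T A) (n : ℕ) (t : T) (s : Fin (n + 1) → T)
    (a : A) :
    M.boundary (n + 1) (Finsupp.single (Fin.cons t s : Fin (n + 2) → T) a) =
      Finsupp.single s (M.act a t) -
        Finsupp.single (Fin.cons (t * s 0) fun i : Fin n => s i.succ) a -
        ∑ j : Fin (n + 1), (-1 : ℤ) ^ ((j : ℕ) + 1) •
          Finsupp.single (Fin.cons t (Fin.contractNth j (· * ·) s) : Fin (n + 1) → T) a := by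
  rw [boundary_single, Fin.sum_univ_succ]
  simp only [cons_contractNth, cons_contractNth_zero, Fin.cons_succ, Fin.cons_zero, Fin.val_zero,
    Fin.val_succ, pow_succ _ (_ + 1), mul_neg, mul_one, neg_smul, Finset.sum_neg_distrib]
  simp only [zero_add, pow_one, neg_smul, one_smul]
  abel

end Naturality

/-! ### The contracting homotopy given by prepending. -/

section Contraction

variable {T A : Type*} [AddCommGroup A]

/-- Prepending: `a [s₁, …, sₙ] ↦ ∑ aₜ [t, s₁, …, sₙ]`, where `κ a = ∑ aₜ t`. -/
noncomputable def prepend (κ : A →+ (T →₀ A)) (n : ℕ) :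
    ((Fin n → T) →₀ A) →+ ((Fin (n + 1) → T) →₀ A) :=
  Finsupp.liftAddHom fun s =>
    (Finsupp.mapDomain.addMonoidHom fun t => (Fin.cons t s : Fin (n + 1) → T)).comp κ

theorem prepend_single (κ : A →+ (T →₀ A)) (n : ℕ) (s : Fin n → T) (a : A) :
    prepend κ n (Finsupp.single s a) = (κ a).mapDomain fun t => (Fin.cons t s : Fin (n + 1) → T) := by
  simp [prepend]

variable [Semigroup T]

theorem boundary_mapDomain_cons (M : SemigroupModule T A) (n : ℕ) (s : Fin (n + 1) → T)
    (c : T →₀ A) :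
    M.boundary (n + 1) (c.mapDomain fun t => (Fin.cons t s : Fin (n + 2) → T)) =
      Finsupp.single s (Finsupp.liftAddHom (fun t => M.actHom t) c) -
        (c.mapDomain (· * s 0)).mapDomain
          (fun t => (Fin.cons t fun i : Fin n => s i.succ : Fin (n + 1) → T)) -
        ∑ j : Fin (n + 1), (-1 : ℤ) ^ ((j : ℕ) + 1) •
          c.mapDomain
            fun t => (Fin.cons t (Fin.contractNth j (· * ·) s) : Fin (n + 1) → T) := by
  induction c using Finsupp.induction_linear with
  | zero => simp
  | add f g hf hg =>
    simp only [Finsupp.mapDomain_add, map_add, hf, hg, Finsupp.single_add, smul_add,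
      Finset.sum_add_distrib]
    abel
  | single t a =>
    rw [Finsupp.mapDomain_single, boundary_single_cons, Finsupp.liftAddHom_apply_single]
    simp [Finsupp.mapDomain_single, actHom]

/-- A contraction in positive degrees, for coefficients `A` that decompose as
`A' ⊕ ⨁_{t ∈ T} A' t`: here `κ` and `κ₁` give the components of an element. -/
theorem boundary_prepend_add (M : SemigroupModule T A) (κ : A →+ (T →₀ A)) (κ₁ : A →+ A)
    (h₁ : ∀ a, Finsupp.liftAddHom (fun t => M.actHom t) (κ a) + κ₁ a = a)
    (h₂ : ∀ a s, κ (M.act a s) = (κ a).mapDomain (· * s) + Finsupp.single s (κ₁ a))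
    (n : ℕ) (c : M.Chains (n + 1)) :
    M.boundary (n + 1) (prepend κ (n + 1) c) + prepend κ n (M.boundary n c) = c := by
  induction c using Finsupp.induction_linear with
  | zero => simp
  | add f g hf hg =>
    simp only [map_add]
    rw [add_add_add_comm, hf, hg]
  | single s a =>
    rw [prepend_single, boundary_mapDomain_cons, boundary_single]
    -- By `h₂`, prepending to the face `a s₀ [s₁, …]` cancels the shifted term and leaves `(κ₁
    -- a)[s]`. Together with the term `(∑ aₜ t)[s]` this is `a[s]` by `h₁`.
    simp only [map_add, map_sum, map_zsmul, prepend_single, h₂, Finsupp.mapDomain_add,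
      Finsupp.mapDomain_single]
    have hs : (Fin.cons (s 0) fun i : Fin n => s i.succ : Fin (n + 1) → T) = s :=
      Fin.cons_self_tail s
    rw [hs]
    conv_rhs => rw [← h₁ a, Finsupp.single_add]
    abel

theorem boundary_boundary_zero (M : SemigroupModule T A) (c : M.Chains 2) :
    M.boundary 0 (M.boundary 1 c) = 0 := by
  induction c using Finsupp.induction_linear with
  | zero => simp
  | add f g hf hg => simp only [map_add, hf, hg, add_zero]
  | single s a =>
    have h : ∀ f g : Fin 0 → T, f = g := fun f g => Subsingleton.elim _ _
    have h1 : ∀ x : Fin (0 + 1) → T, ∀ b, M.boundary 0 (Finsupp.single x b) =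
        Finsupp.single Fin.elim0 (M.act b (x 0)) - Finsupp.single Fin.elim0 b := by
      intro x b
      rw [boundary_single]
      simp [h _ Fin.elim0, sub_eq_add_neg]
    rw [boundary_single]
    simp [Fin.sum_univ_two, h1, Fin.contractNth, M.act_mul]

end Contraction

/-! ### The ring `ℤ[T¹]` as universal coefficients. -/

section Universal

theorem _root_.MonoidAlgebra.addMonoidHom_ext_of {G N : Type*} [Monoid G] [AddCommGroup N]
    {f g : MonoidAlgebra ℤ G →+ N}
    (h : ∀ x, f (MonoidAlgebra.of ℤ G x) = g (MonoidAlgebra.of ℤ G x)) : f = g :=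
  MonoidAlgebra.addHom_ext' fun x => AddMonoidHom.ext_int (h x)

/-- The additive extension of a map on `G` to `ℤ[G]`. -/
noncomputable def _root_.MonoidAlgebra.extend {G N : Type*} [AddCommGroup N] (f : G → N) :
    MonoidAlgebra ℤ G →+ N :=
  (Finsupp.liftAddHom fun x => zmultiplesHom N (f x)).comp
    MonoidAlgebra.coeffAddEquiv.toAddMonoidHom

@[simp]
theorem _root_.MonoidAlgebra.extend_of {G N : Type*} [Monoid G] [AddCommGroup N] (f : G → N)
    (x : G) : MonoidAlgebra.extend f (MonoidAlgebra.of ℤ G x) = f x := by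
  simp [MonoidAlgebra.extend, MonoidAlgebra.of, MonoidAlgebra.coeffAddEquiv]

variable {T S A : Type*} [Semigroup T] [Semigroup S] [AddCommGroup A]

/-- The integral semigroup ring with a unit adjoined. -/
abbrev UnitalRing (T : Type*) [Semigroup T] : Type _ := MonoidAlgebra ℤ (WithOne T)

/-- The ring `ℤ[T¹]` as a right module over `T`. -/
noncomputable def regular (T : Type*) [Semigroup T] : SemigroupModule T (UnitalRing T) where
  act r t := r * MonoidAlgebra.of ℤ _ (t : WithOne T)
  add_act a b s := add_mul a b _
  act_mul a s t := by rw [WithOne.coe_mul, map_mul, mul_assoc]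

@[simp]
theorem regular_act (r : UnitalRing T) (t : T) :
    (regular T).act r t = r * MonoidAlgebra.of ℤ _ (t : WithOne T) := rfl

/-- The action of `T¹` on a right `T`-module. -/
noncomputable def unitalAction (M : SemigroupModule T A) :
    WithOne T →* (AddMonoid.End A)ᵐᵒᵖ :=
  WithOne.lift ⟨fun t => MulOpposite.op (M.actHom t : AddMonoid.End A), fun s t =>
    MulOpposite.unop_injective (AddMonoidHom.ext fun a => M.act_mul a s t)⟩

/-- The action of `ℤ[T¹]` on a right `T`-module. -/
noncomputable def ringAction (M : SemigroupModule T A) :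
    UnitalRing T →ₐ[ℤ] (AddMonoid.End A)ᵐᵒᵖ :=
  MonoidAlgebra.lift ℤ _ _ M.unitalAction

/-- The module homomorphism `r ↦ a r` from `ℤ[T¹]` to `A`. -/
noncomputable def orbit (M : SemigroupModule T A) (a : A) : UnitalRing T →+ A where
  toFun r := (M.ringAction r).unop a
  map_zero' := by simp
  map_add' r r' := by rw [map_add]; rfl

theorem orbit_add (M : SemigroupModule T A) (a b : A) (r : UnitalRing T) :
    M.orbit (a + b) r = M.orbit a r + M.orbit b r :=
  map_add (M.ringAction r).unop a b

theorem orbit_mul (M : SemigroupModule T A) (a : A) (r r' : UnitalRing T) :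
    M.orbit a (r * r') = M.orbit (M.orbit a r) r' := by
  simp [orbit]

@[simp]
theorem orbit_one (M : SemigroupModule T A) (a : A) : M.orbit a 1 = a := by
  simp [orbit]

@[simp]
theorem orbit_of (M : SemigroupModule T A) (a : A) (t : T) :
    M.orbit a (MonoidAlgebra.of ℤ _ (t : WithOne T)) = M.act a t := by
  simp only [orbit, ringAction, AddMonoidHom.coe_mk, ZeroHom.coe_mk, MonoidAlgebra.lift_of]
  simp only [unitalAction, WithOne.lift_coe]
  rfl

theorem orbit_act (M : SemigroupModule T A) (a : A) (r : UnitalRing T) (t : T) :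
    M.orbit a ((regular T).act r t) = M.act (M.orbit a r) t := by
  rw [regular_act, orbit_mul, orbit_of]

/-- The `T`-component of an element of `ℤ[G]` along a decomposition `G → G × T¹`. -/
noncomputable def component {G : Type*} [Monoid G] (dec : G → G × WithOne T) :
    MonoidAlgebra ℤ G →+ (T →₀ MonoidAlgebra ℤ G) :=
  MonoidAlgebra.extend fun g =>
    -- The adjoined unit is no element of `T` and cannot be prepended; `unitComponent` keeps these
    -- terms.
    WithOne.recOneCoe (motive := fun _ => T →₀ MonoidAlgebra ℤ G) 0
      (fun t => Finsupp.single t (MonoidAlgebra.of ℤ G (dec g).1)) (dec g).2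

/-- The unit component of an element of `ℤ[G]` along a decomposition `G → G × T¹`. -/
noncomputable def unitComponent {G : Type*} [Monoid G] (dec : G → G × WithOne T) :
    MonoidAlgebra ℤ G →+ MonoidAlgebra ℤ G :=
  MonoidAlgebra.extend fun g =>
    WithOne.recOneCoe (motive := fun _ => MonoidAlgebra ℤ G)
      (MonoidAlgebra.of ℤ G (dec g).1) (fun _ => 0) (dec g).2

/-- If `S¹` is a free right `T¹`-set along `f : T → S`, then the complex of `T` with coefficients
in `ℤ[S¹]` is contractible in positive degrees. -/
theorem boundary_prepend_component (f : T →ₙ* S) (dec : WithOne S → WithOne S × WithOne T)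
    (h₁ : ∀ x, (dec x).1 * WithOne.mapMulHom f (dec x).2 = x)
    (h₂ : ∀ x (t : T), dec (x * (f t : S)) = ((dec x).1, (dec x).2 * (t : WithOne T)))
    (n : ℕ) (c : ((regular S).restrict f).Chains (n + 1)) :
    ((regular S).restrict f).boundary (n + 1) (prepend (component dec) (n + 1) c) +
      prepend (component dec) n (((regular S).restrict f).boundary n c) = c := by
  refine boundary_prepend_add _ _ (unitComponent dec) (fun a => ?_) (fun a s => ?_) n c
  · refine DFunLike.congr_fun (f := (Finsupp.liftAddHom _).comp (component dec) +
      unitComponent dec) (g := AddMonoidHom.id _) (MonoidAlgebra.addMonoidHom_ext_of fun x => ?_) a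
    have hx := h₁ x
    simp only [AddMonoidHom.add_apply, AddMonoidHom.comp_apply, component, unitComponent,
      MonoidAlgebra.extend_of, AddMonoidHom.id_apply]
    generalize dec x = p at hx
    obtain ⟨y, t⟩ := p
    subst hx
    cases t with
    | one => simp
    | coe t =>
      simp [actHom, restrict, regular, WithOne.recOneCoe_coe]
  · refine DFunLike.congr_fun (f := (component dec).comp (((regular S).restrict f).actHom s))
      (g := (Finsupp.mapDomain.addMonoidHom (· * s)).comp (component dec) +
        (Finsupp.singleAddHom s).comp (unitComponent dec))
      (MonoidAlgebra.addMonoidHom_ext_of fun x => ?_) a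
    have hx : ((regular S).restrict f).actHom s (MonoidAlgebra.of ℤ _ x) =
        MonoidAlgebra.of ℤ _ (x * (f s : S)) := by
      simp [actHom, restrict, regular]
    simp only [AddMonoidHom.add_apply, AddMonoidHom.comp_apply, hx]
    simp only [component, unitComponent, MonoidAlgebra.extend_of, h₂]
    generalize dec x = p
    obtain ⟨y, t⟩ := p
    cases t with
    | one => simp [WithOne.recOneCoe_coe]
    | coe t =>
      rw [← WithOne.coe_mul]
      simp only [WithOne.recOneCoe_coe]
      simp [Finsupp.mapDomain_single]

theorem regular_boundary_prepend (n : ℕ) (c : (regular S).Chains (n + 1)) :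
    (regular S).boundary (n + 1) (prepend (component fun x => (1, x)) (n + 1) c) +
      prepend (component fun x => (1, x)) n ((regular S).boundary n c) = c :=
  boundary_prepend_component (MulHom.id S) (fun x => (1, x)) (by simp) (by simp) n c

/-- Reduces identities natural in the coefficients to chains `1[s]` over `ℤ[S¹]`. -/
theorem single_eq_mapRange_orbit (M : SemigroupModule S A) {n : ℕ} (s : Fin n → S) (a : A) :
    (Finsupp.single s a : M.Chains n) =
      Finsupp.mapRange.addMonoidHom (M.orbit a) (Finsupp.single s 1) := by
  simp

/-- No double sum over faces is needed: over `ℤ[S¹]`, with `P` the contraction, `∂P = 1 - P∂` gives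
`∂∂P = ∂ - (1 - P∂)∂ = P∂∂`, which vanishes by induction on the degree. -/
theorem boundary_boundary (M : SemigroupModule S A) (n : ℕ) (c : M.Chains (n + 2)) :
    M.boundary n (M.boundary (n + 1) c) = 0 := by
  suffices h : ∀ c : (regular S).Chains (n + 2),
      (regular S).boundary n ((regular S).boundary (n + 1) c) = 0 by
    induction c using Finsupp.induction_linear with
    | zero => simp
    | add f g hf hg => simp only [map_add, hf, hg, add_zero]
    | single s a =>
      rw [single_eq_mapRange_orbit M, boundary_mapRange (M := regular S) _ (M.orbit_act a),
        boundary_mapRange (M := regular S) _ (M.orbit_act a), h, map_zero]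
  clear c
  induction n with
  | zero => exact boundary_boundary_zero _
  | succ n ih =>
    intro c
    induction c using Finsupp.induction_linear with
    | zero => simp
    | add f g hf hg => simp only [map_add, hf, hg, add_zero]
    | single s a =>
      -- Every `1[s₀, s₁, …]` is in the image of `P`, namely `P(s₀[s₁, …])`.
      have hs : (Finsupp.single s 1 : (regular S).Chains (n + 3)) =
          prepend (component fun x => (1, x)) (n + 2)
            (Finsupp.single (fun i => s i.succ) (MonoidAlgebra.of ℤ _ (s 0 : WithOne S))) := by
        rw [prepend_single]
        simp only [component, MonoidAlgebra.extend_of, WithOne.recOneCoe_coe,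
          Finsupp.mapDomain_single, map_one]
        congr 1
        exact (Fin.cons_self_tail s).symm
      rw [single_eq_mapRange_orbit (regular S), boundary_mapRange _ ((regular S).orbit_act a),
        boundary_mapRange _ ((regular S).orbit_act a), hs,
        eq_sub_of_add_eq (regular_boundary_prepend (n + 1) _), map_sub,
        eq_sub_of_add_eq (regular_boundary_prepend n ((regular S).boundary (n + 1) _)), ih]
      simp

end Universal

end SemigroupModule

namespace SemigroupModule

/-! ### Change of semigroup, and left linearity over `ℤ[S¹]`. -/

section Functoriality

variable {T S A : Type*} [Semigroup T] [Semigroup S] [AddCommGroup A]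

/-- The boundary is natural in the semigroup. -/
theorem boundary_mapDomain (M : SemigroupModule S A) (f : T →ₙ* S) (n : ℕ)
    (c : (M.restrict f).Chains (n + 1)) :
    M.boundary n (c.mapDomain fun s : Fin (n + 1) → T => (f ∘ s : Fin (n + 1) → S)) =
      ((M.restrict f).boundary n c).mapDomain fun s : Fin n → T => (f ∘ s : Fin n → S) := by
  induction c using Finsupp.induction_linear with
  | zero => simp
  | add f g hf hg => simp only [Finsupp.mapDomain_add, map_add, hf, hg]
  | single s a =>
    rw [Finsupp.mapDomain_single, boundary_single, boundary_single, Finsupp.mapDomain_add,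
      Finsupp.mapDomain_single, Finsupp.mapDomain_finsetSum]
    congr 1
    refine Finset.sum_congr rfl fun j _ => ?_
    rw [Finsupp.mapDomain_smul, Finsupp.mapDomain_single]
    congr 2
    funext k
    simp only [Fin.contractNth, Function.comp_apply]
    split_ifs <;> simp

/-- Turns naturality in the coefficients into left linearity, as left multiplication commutes with
the right action. -/
theorem mapRange_mulLeft {X R : Type*} [Ring R] (r : R) (c : X →₀ R) :
    Finsupp.mapRange.addMonoidHom (AddMonoidHom.mulLeft r) c = r • c := by
  ext x
  simp

/-- The boundary with coefficients in `ℤ[S¹]` as a left linear map. -/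
noncomputable def linearBoundary (S : Type*) [Semigroup S] (n : ℕ) :
    ((Fin (n + 1) → S) →₀ UnitalRing S) →ₗ[UnitalRing S] ((Fin n → S) →₀ UnitalRing S) where
  __ := (regular S).boundary n
  map_smul' r c := by
    have h := boundary_mapRange (M := regular S) (M' := regular S) (AddMonoidHom.mulLeft r)
      (fun a s => by simp [mul_assoc]) n c
    rw [mapRange_mulLeft, mapRange_mulLeft] at h
    exact h

theorem linearBoundary_apply (n : ℕ) (c : (Fin (n + 1) → S) →₀ UnitalRing S) :
    linearBoundary S n c = (regular S).boundary n c := rfl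

end Functoriality

end SemigroupModule

/-! ### Universal property of the free product, syllable decomposition, crossed homomorphisms. -/

namespace SemigroupFreeProduct

open SemigroupModule

variable {Λ : Type*} {S : Λ → Type*} [∀ l, Semigroup (S l)]

/-- The homomorphism from the free product given by homomorphisms on the factors. -/
def lift {N : Type*} [Semigroup N] (φ : ∀ l, S l →ₙ* N) : SemigroupFreeProduct S →ₙ* N where
  toFun x := Con.liftOn x (FreeSemigroup.lift fun p : Σ l, S l => φ p.1 p.2) fun a b h => by
    induction h with
    | of a b h =>
      cases h with
      | mul l s t => simp
    | refl => rfl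
    | symm _ ih => exact ih.symm
    | trans _ _ ih ih' => exact ih.trans ih'
    | mul _ _ ih ih' => rw [map_mul, map_mul, ih, ih']
  map_mul' x y := by
    induction x, y using Con.induction_on₂ with
    | H a b => exact map_mul (FreeSemigroup.lift fun p : Σ l, S l => φ p.1 p.2) a b

@[simp]
theorem lift_incl {N : Type*} [Semigroup N] (φ : ∀ l, S l →ₙ* N) (l : Λ) (s : S l) :
    lift φ (incl S l s) = φ l s :=
  FreeSemigroup.lift_of (fun p : Σ l, S l => φ p.1 p.2) ⟨l, s⟩

theorem induction_on {p : SemigroupFreeProduct S → Prop} (x : SemigroupFreeProduct S)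
    (incl : ∀ l s, p (incl S l s)) (mul : ∀ x y, p x → p y → p (x * y)) : p x := by
  induction x using Con.induction_on with
  | H a =>
    induction a using FreeSemigroup.recOnMul with
    | ih1 a => exact incl a.1 a.2
    | ih2 a b ha hb => exact mul _ _ ha hb

section Decomposition

variable (S)

/-- The canonical homomorphism from a factor to the free product, with units adjoined. -/
abbrev unitalIncl (l : Λ) : WithOne (S l) →* WithOne (SemigroupFreeProduct S) :=
  WithOne.mapMulHom (incl S l)

open Classical in
/-- The action of an element of a factor on pairs `(y, t)`, which stand for the product `y t` with
`t` in the factor with index `l`. -/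
noncomputable def pairStep (l m : Λ) (s : S m)
    (z : WithOne (SemigroupFreeProduct S) × WithOne (S l)) :
    WithOne (SemigroupFreeProduct S) × WithOne (S l) :=
  if h : m = l then (z.1, z.2 * ((h ▸ s : S l) : WithOne (S l)))
  else (z.1 * unitalIncl S l z.2 * (incl S m s : SemigroupFreeProduct S), 1)

theorem pairStep_self (l : Λ) (s : S l)
    (z : WithOne (SemigroupFreeProduct S) × WithOne (S l)) :
    pairStep S l l s z = (z.1, z.2 * (s : WithOne (S l))) := by
  simp [pairStep]

/-- This is what lets `lift` define an action of the whole free product on pairs, so that no normal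
form of words is needed. -/
theorem pairStep_mul (l m : Λ) (s t : S m)
    (z : WithOne (SemigroupFreeProduct S) × WithOne (S l)) :
    pairStep S l m (s * t) z = pairStep S l m t (pairStep S l m s z) := by
  by_cases h : m = l
  · subst h
    simp [pairStep_self, mul_assoc]
  · simp [pairStep, h, mul_assoc]

theorem pairStep_prod (l m : Λ) (s : S m)
    (z : WithOne (SemigroupFreeProduct S) × WithOne (S l)) :
    (pairStep S l m s z).1 * unitalIncl S l (pairStep S l m s z).2 =
      z.1 * unitalIncl S l z.2 * (incl S m s : SemigroupFreeProduct S) := by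
  by_cases h : m = l
  · subst h
    simp [pairStep_self, mul_assoc]
  · simp [pairStep, h]

/-- The right action of the free product on pairs `(y, t)`. -/
noncomputable def pairAction (l : Λ) : SemigroupFreeProduct S →ₙ*
    (Function.End (WithOne (SemigroupFreeProduct S) × WithOne (S l)))ᵐᵒᵖ :=
  lift fun m =>
    { toFun := fun s => MulOpposite.op (pairStep S l m s)
      map_mul' := fun s t =>
        MulOpposite.unop_injective (funext fun z => pairStep_mul S l m s t z) }

theorem pairAction_incl (l m : Λ) (s : S m)
    (z : WithOne (SemigroupFreeProduct S) × WithOne (S l)) :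
    (pairAction S l (incl S m s)).unop z = pairStep S l m s z := by
  rw [pairAction, lift_incl]
  rfl

theorem pairAction_mul (l : Λ) (x y : SemigroupFreeProduct S)
    (z : WithOne (SemigroupFreeProduct S) × WithOne (S l)) :
    (pairAction S l (x * y)).unop z =
      (pairAction S l y).unop ((pairAction S l x).unop z) := by
  rw [map_mul]
  rfl

theorem pairAction_prod (l : Λ) (x : SemigroupFreeProduct S)
    (z : WithOne (SemigroupFreeProduct S) × WithOne (S l)) :
    ((pairAction S l x).unop z).1 * unitalIncl S l ((pairAction S l x).unop z).2 =
      z.1 * unitalIncl S l z.2 * x := by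
  induction x using induction_on generalizing z with
  | incl m s => rw [pairAction_incl, pairStep_prod]
  | mul x y hx hy => rw [pairAction_mul, hy, hx, WithOne.coe_mul, ← mul_assoc]

/-- The decomposition `x = y t` of elements of the free product with a unit adjoined, where `t` is
the last syllable of `x` if this belongs to the factor with index `l`, and `t = 1` otherwise. -/
noncomputable def decompose (l : Λ) (x : WithOne (SemigroupFreeProduct S)) :
    WithOne (SemigroupFreeProduct S) × WithOne (S l) :=
  WithOne.recOneCoe (motive := fun _ => WithOne (SemigroupFreeProduct S) × WithOne (S l)) (1, 1)
    (fun x => (pairAction S l x).unop (1, 1)) x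

theorem decompose_prod (l : Λ) (x : WithOne (SemigroupFreeProduct S)) :
    (decompose S l x).1 * unitalIncl S l (decompose S l x).2 = x := by
  cases x with
  | one => simp [decompose]
  | coe x =>
    simp only [decompose, WithOne.recOneCoe_coe]
    rw [pairAction_prod]
    simp

/-- A letter of the factor `l` changes only the second component of a pair. With `decompose_prod`
this makes `S¹` a free right `S_l¹`-set. -/
theorem decompose_mul (l : Λ) (x : WithOne (SemigroupFreeProduct S)) (t : S l) :
    decompose S l (x * (incl S l t : SemigroupFreeProduct S)) =
      ((decompose S l x).1, (decompose S l x).2 * (t : WithOne (S l))) := by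
  cases x with
  | one =>
    rw [one_mul]
    simp only [decompose, WithOne.recOneCoe_coe, WithOne.recOneCoe_one]
    rw [pairAction_incl, pairStep_self]
  | coe x =>
    rw [← WithOne.coe_mul]
    simp only [decompose, WithOne.recOneCoe_coe]
    rw [pairAction_mul, pairAction_incl, pairStep_self]

end Decomposition

/-- Crossed homomorphisms on the factors extend to the free product. -/
theorem exists_crossedHom {Q : Type*} [AddCommGroup Q]
    [Module (UnitalRing (SemigroupFreeProduct S)) Q] (D : ∀ l, S l → Q)
    (hD : ∀ l s t, D l (s * t) = D l s +
      MonoidAlgebra.of ℤ _ (incl S l s : WithOne (SemigroupFreeProduct S)) • D l t) :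
    ∃ D' : SemigroupFreeProduct S → Q, (∀ l s, D' (incl S l s) = D l s) ∧
      ∀ x y : SemigroupFreeProduct S,
        D' (x * y) = D' x + MonoidAlgebra.of ℤ _ (x : WithOne (SemigroupFreeProduct S)) • D' y := by
  -- A crossed homomorphism is the translation part of an action by affine maps `q ↦ D s + s q`;
  -- such actions extend by `lift`, and `D'` is the value at `0`.
  let F : SemigroupFreeProduct S →ₙ* Function.End Q := lift fun l =>
    { toFun := fun s q => D l s +
        MonoidAlgebra.of ℤ _ (incl S l s : WithOne (SemigroupFreeProduct S)) • q
      map_mul' := fun s t => funext fun q => by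
        change D l (s * t) + _ • q = D l s + _ • (D l t + _ • q)
        rw [hD, map_mul, WithOne.coe_mul, map_mul, mul_smul, smul_add, add_assoc] }
  have hincl : ∀ l s q, F (incl S l s) q = D l s +
      MonoidAlgebra.of ℤ _ (incl S l s : WithOne (SemigroupFreeProduct S)) • q := by
    intro l s q
    simp only [F]
    rw [lift_incl]
    rfl
  have hmul : ∀ x y q, F (x * y) q = F x (F y q) := fun x y q => by
    rw [map_mul]
    rfl
  have hF : ∀ x q, F x q = F x 0 + MonoidAlgebra.of ℤ _ (x : WithOne (SemigroupFreeProduct S)) • q := by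
    intro x
    induction x using induction_on with
    | incl l s =>
      intro q
      rw [hincl, hincl, smul_zero, add_zero]
    | mul x y hx hy =>
      intro q
      rw [hmul, hmul, hx, hx (F y 0), hy, smul_add, WithOne.coe_mul, map_mul, mul_smul, add_assoc]
  refine ⟨fun x => F x 0, fun l s => ?_, fun x y => ?_⟩
  · simp [hincl]
  · exact (hmul x y 0).trans (hF x _)

end SemigroupFreeProduct

/-! ### The comparison theorem for complexes of free modules. -/

section Comparison

theorem exists_dependent_seq {T : ℕ → Type*} (good : ∀ m, T m → Prop)
    (r : ∀ m, T m → T (m + 1) → Prop) (t₀ : T 0) (h₀ : good 0 t₀)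
    (step : ∀ m t, good m t → ∃ t', r m t t' ∧ good (m + 1) t') :
    ∃ f : ∀ m, T m, f 0 = t₀ ∧ ∀ m, r m (f m) (f (m + 1)) := by
  choose next hr hgood using step
  let F : ∀ m, {t : T m // good m t} := fun m =>
    Nat.rec (motive := fun m => {t : T m // good m t}) ⟨t₀, h₀⟩
      (fun m t => ⟨next m t.1 t.2, hgood m t.1 t.2⟩) m
  exact ⟨fun m => (F m).1, rfl, fun m => hr m (F m).1 (F m).2⟩

variable {R : Type*} [Ring R]

/-- Projectivity of free modules: lift the images of the basis. -/
theorem Finsupp.exists_comp_eq {X N N' : Type*} [AddCommGroup N] [Module R N] [AddCommGroup N']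
    [Module R N'] (f : (X →₀ R) →ₗ[R] N) (g : N' →ₗ[R] N)
    (h : ∀ x, f (Finsupp.single x 1) ∈ LinearMap.range g) : ∃ k : (X →₀ R) →ₗ[R] N', g ∘ₗ k = f := by
  choose b hb using h
  refine ⟨Finsupp.linearCombination R b, Finsupp.lhom_ext' fun x => LinearMap.ext_ring ?_⟩
  simp [hb]

variable {X Y : ℕ → Type*} (dX : ∀ m, (X (m + 1) →₀ R) →ₗ[R] (X m →₀ R))
  (dY : ∀ m, (Y (m + 1) →₀ R) →ₗ[R] (Y m →₀ R))

/-- A map from a complex of free modules to an exact complex extends to a chain map. -/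
theorem exists_chainMap (hX : ∀ m, dX m ∘ₗ dX (m + 1) = 0)
    (hY : ∀ m, LinearMap.ker (dY m) ≤ LinearMap.range (dY (m + 1)))
    (f₀ : (X 0 →₀ R) →ₗ[R] (Y 0 →₀ R)) (h₀ : ∀ c, f₀ (dX 0 c) ∈ LinearMap.range (dY 0)) :
    ∃ f : ∀ m, (X m →₀ R) →ₗ[R] (Y m →₀ R), f 0 = f₀ ∧
      ∀ m, dY m ∘ₗ f (m + 1) = f m ∘ₗ dX m := by
  refine exists_dependent_seq (T := fun m => (X m →₀ R) →ₗ[R] (Y m →₀ R))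
    -- The invariant is exactly what the next lifting needs; exactness of `dY` restores it.
    (fun m f => ∀ c, f (dX m c) ∈ LinearMap.range (dY m))
    (fun m f f' => dY m ∘ₗ f' = f ∘ₗ dX m) f₀ h₀ fun m f hf => ?_
  obtain ⟨f', hf'⟩ := Finsupp.exists_comp_eq (f ∘ₗ dX m) (dY m) fun x => hf _
  refine ⟨f', hf', fun c => hY m ?_⟩
  rw [LinearMap.mem_ker]
  have h1 := LinearMap.congr_fun hf' (dX (m + 1) c)
  have h2 := LinearMap.congr_fun (hX m) c
  simp only [LinearMap.comp_apply, LinearMap.zero_apply] at h1 h2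
  rw [h1, h2, map_zero]

/-- A chain map from a complex of free modules to an exact complex is null-homotopic if it is so
in degree zero. -/
theorem exists_nullHomotopy (hX : ∀ m, dX m ∘ₗ dX (m + 1) = 0)
    (hY : ∀ m, LinearMap.ker (dY m) ≤ LinearMap.range (dY (m + 1)))
    (f : ∀ m, (X m →₀ R) →ₗ[R] (Y m →₀ R)) (hf : ∀ m, dY m ∘ₗ f (m + 1) = f m ∘ₗ dX m)
    (h₀ : ∀ c, f 0 c ∈ LinearMap.range (dY 0)) :
    ∃ h : ∀ m, (X m →₀ R) →ₗ[R] (Y (m + 1) →₀ R),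
      ∀ m, dY (m + 1) ∘ₗ h (m + 1) + h m ∘ₗ dX m = f (m + 1) := by
  obtain ⟨k₀, hk₀⟩ := Finsupp.exists_comp_eq (f 0) (dY 0) fun x => h₀ _
  obtain ⟨h, -, hh⟩ := exists_dependent_seq (T := fun m => (X m →₀ R) →ₗ[R] (Y (m + 1) →₀ R))
    -- The invariant says that `f (m + 1) - k ∘ dX m` has values in the kernel of `dY m`, hence in
    -- the range of `dY (m + 1)`.
    (fun m k => dY m ∘ₗ k ∘ₗ dX m = dY m ∘ₗ f (m + 1))
    (fun m k k' => dY (m + 1) ∘ₗ k' + k ∘ₗ dX m = f (m + 1)) k₀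
    (by rw [← LinearMap.comp_assoc, hk₀, hf]) fun m k hk => by
      obtain ⟨k', hk'⟩ := Finsupp.exists_comp_eq (f (m + 1) - k ∘ₗ dX m) (dY (m + 1)) fun x => by
        refine hY m ?_
        have h1 := LinearMap.congr_fun hk (Finsupp.single x 1)
        simp only [LinearMap.comp_apply] at h1
        simp only [LinearMap.mem_ker, LinearMap.sub_apply, LinearMap.comp_apply, map_sub, h1,
          sub_self]
      have hk'' : ∀ c, dY (m + 1) (k' c) = f (m + 1) c - k (dX m c) := LinearMap.congr_fun hk'
      refine ⟨k', LinearMap.ext fun c => ?_, LinearMap.ext fun c => ?_⟩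
      · simp only [LinearMap.add_apply, LinearMap.comp_apply, hk'', sub_add_cancel]
      · have h1 := LinearMap.congr_fun (hX m) c
        have h2 := LinearMap.congr_fun (hf (m + 1)) c
        simp only [LinearMap.comp_apply, LinearMap.zero_apply] at h1 h2 ⊢
        rw [hk'', h1, h2, map_zero, sub_zero]
  exact ⟨h, hh⟩

end Comparison

namespace SemigroupModule

/-! ### The functor `A ⊗ -` on free modules over `ℤ[S¹]`. -/

section BaseChange

variable {S A X Y Z : Type*} [Semigroup S] [AddCommGroup A]

/-- The map `A ⊗ f` between direct sums of copies of `A`, for a linear map `f` between free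
modules over `ℤ[S¹]`. -/
noncomputable def baseChange (M : SemigroupModule S A)
    (f : (X →₀ UnitalRing S) →ₗ[UnitalRing S] (Y →₀ UnitalRing S)) : (X →₀ A) →+ (Y →₀ A) :=
  Finsupp.liftAddHom fun x => AddMonoidHom.mk'
    (fun a => Finsupp.mapRange.addMonoidHom (M.orbit a) (f (Finsupp.single x 1)))
    fun a b => by
      ext y
      simp [orbit_add]

@[simp]
theorem baseChange_single (M : SemigroupModule S A)
    (f : (X →₀ UnitalRing S) →ₗ[UnitalRing S] (Y →₀ UnitalRing S)) (x : X) (a : A) :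
    M.baseChange f (Finsupp.single x a) =
      Finsupp.mapRange.addMonoidHom (M.orbit a) (f (Finsupp.single x 1)) := by
  rw [baseChange, Finsupp.liftAddHom_apply_single]
  rfl

theorem baseChange_mapRange_orbit (M : SemigroupModule S A)
    (f : (X →₀ UnitalRing S) →ₗ[UnitalRing S] (Y →₀ UnitalRing S)) (a : A)
    (c : X →₀ UnitalRing S) :
    M.baseChange f (Finsupp.mapRange.addMonoidHom (M.orbit a) c) =
      Finsupp.mapRange.addMonoidHom (M.orbit a) (f c) := by
  induction c using Finsupp.induction_linear with
  | zero => simp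
  | add c c' hc hc' => simp only [map_add, hc, hc']
  | single x r =>
    have h : (Finsupp.single x r : X →₀ UnitalRing S) = r • Finsupp.single x 1 := by simp
    rw [Finsupp.mapRange.addMonoidHom_apply, Finsupp.mapRange_single, baseChange_single, h,
      f.map_smul]
    ext y
    simp [orbit_mul]

/-- Applying `M.orbit a` to the coefficients of `c` is forming `a ⊗ c`; the elements `a ⊗ 1[x]`
generate, so compatibility with `a ⊗ -` determines the map. -/
theorem baseChange_eq (M : SemigroupModule S A)
    (f : (X →₀ UnitalRing S) →ₗ[UnitalRing S] (Y →₀ UnitalRing S)) (F : (X →₀ A) →+ (Y →₀ A))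
    (h : ∀ a c, F (Finsupp.mapRange.addMonoidHom (M.orbit a) c) =
      Finsupp.mapRange.addMonoidHom (M.orbit a) (f c)) : M.baseChange f = F := by
  refine Finsupp.addHom_ext fun x a => ?_
  rw [baseChange_single, ← h]
  simp

theorem baseChange_comp (M : SemigroupModule S A)
    (g : (Y →₀ UnitalRing S) →ₗ[UnitalRing S] (Z →₀ UnitalRing S))
    (f : (X →₀ UnitalRing S) →ₗ[UnitalRing S] (Y →₀ UnitalRing S)) :
    M.baseChange (g ∘ₗ f) = (M.baseChange g).comp (M.baseChange f) :=
  baseChange_eq _ _ _ fun a c => by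
    simp only [AddMonoidHom.comp_apply, LinearMap.comp_apply, baseChange_mapRange_orbit]

theorem baseChange_id (M : SemigroupModule S A) :
    M.baseChange (LinearMap.id : (X →₀ UnitalRing S) →ₗ[UnitalRing S] _) = AddMonoidHom.id _ :=
  baseChange_eq _ _ _ fun _ _ => rfl

theorem baseChange_add (M : SemigroupModule S A)
    (f g : (X →₀ UnitalRing S) →ₗ[UnitalRing S] (Y →₀ UnitalRing S)) :
    M.baseChange (f + g) = M.baseChange f + M.baseChange g :=
  baseChange_eq _ _ _ fun a c => by
    rw [AddMonoidHom.add_apply, baseChange_mapRange_orbit, baseChange_mapRange_orbit,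
      LinearMap.add_apply, map_add]

theorem baseChange_sub (M : SemigroupModule S A)
    (f g : (X →₀ UnitalRing S) →ₗ[UnitalRing S] (Y →₀ UnitalRing S)) :
    M.baseChange (f - g) = M.baseChange f - M.baseChange g :=
  baseChange_eq _ _ _ fun a c => by
    rw [AddMonoidHom.sub_apply, baseChange_mapRange_orbit, baseChange_mapRange_orbit,
      LinearMap.sub_apply, map_sub]

end BaseChange

end SemigroupModule

namespace SemigroupFreeProduct

open SemigroupModule

/-! ### The direct sum of the complexes of the factors. -/

section Split

variable {Λ : Type*} {S : Λ → Type*} {A : Type*} [AddCommGroup A]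

/-- The component of a chain in a factor. -/
noncomputable def splitHom (A : Type*) [AddCommGroup A] (n : ℕ) (l : Λ) :
    ((Σ l, Fin n → S l) →₀ A) →+ ((Fin n → S l) →₀ A) :=
  AddMonoidHom.mk' (fun c => c.split l) fun c c' => by
    ext s
    simp [Finsupp.split_apply]

theorem splitHom_apply (n : ℕ) (l : Λ) (c : (Σ l, Fin n → S l) →₀ A) (s : Fin n → S l) :
    splitHom A n l c s = c ⟨l, s⟩ :=
  Finsupp.split_apply _ _ _

theorem splitHom_mapDomain_self (n : ℕ) (l : Λ) (c : (Fin n → S l) →₀ A) :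
    splitHom A n l (c.mapDomain (Sigma.mk l)) = c := by
  ext s
  rw [splitHom_apply, Finsupp.mapDomain_apply sigma_mk_injective]

theorem splitHom_mapDomain_of_ne (n : ℕ) {l m : Λ} (h : l ≠ m) (c : (Fin n → S m) →₀ A) :
    splitHom A n l (c.mapDomain (Sigma.mk m)) = 0 := by
  ext s
  rw [splitHom_apply, Finsupp.mapDomain_of_notMem_range]
  · rfl
  · rintro ⟨t, ht⟩
    exact h (congrArg Sigma.fst ht).symm

theorem sum_mapDomain_splitHom (n : ℕ) (c : (Σ l, Fin n → S l) →₀ A) :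
    ∑ l ∈ c.splitSupport, (splitHom A n l c).mapDomain (Sigma.mk l) = c := by
  classical
  ext ⟨m, s⟩
  have h : ∀ l, ((splitHom A n l c).mapDomain (Sigma.mk l)) (⟨m, s⟩ : Σ l, Fin n → S l) =
      if m = l then c ⟨m, s⟩ else 0 := by
    intro l
    rw [← splitHom_apply (S := S) n m]
    split_ifs with h
    · subst h
      rw [splitHom_mapDomain_self, splitHom_apply]
    · rw [splitHom_mapDomain_of_ne _ h]
      rfl
  simp only [Finsupp.finsetSum_apply, h, Finset.sum_ite_eq]
  split_ifs with hm
  · rfl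
  · rw [Finsupp.mem_splitSupport_iff_nonzero, not_not] at hm
    rw [← Finsupp.split_apply, hm]
    rfl

end Split

variable {Λ : Type*} {S : Λ → Type*} [∀ l, Semigroup (S l)] {A A' : Type*} [AddCommGroup A]
  [AddCommGroup A']

/-- The boundary of the direct sum of the chain complexes of the factors, where `n`-chains of the
direct sum are finite sums over `n`-tuples of elements of the same factor. -/
noncomputable def factorBoundary (M : SemigroupModule (SemigroupFreeProduct S) A) (n : ℕ) :
    ((Σ l, Fin (n + 1) → S l) →₀ A) →+ ((Σ l, Fin n → S l) →₀ A) :=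
  Finsupp.liftAddHom fun x =>
    (Finsupp.mapDomain.addMonoidHom (Sigma.mk x.1)).comp
      (((M.restrict (incl S x.1)).boundary n).comp (Finsupp.singleAddHom x.2))

theorem factorBoundary_single (M : SemigroupModule (SemigroupFreeProduct S) A) (n : ℕ) (l : Λ)
    (s : Fin (n + 1) → S l) (a : A) :
    factorBoundary M n (Finsupp.single ⟨l, s⟩ a) =
      ((M.restrict (incl S l)).boundary n (Finsupp.single s a)).mapDomain (Sigma.mk l) := by
  rw [factorBoundary, Finsupp.liftAddHom_apply_single]
  rfl

theorem factorBoundary_mapDomain (M : SemigroupModule (SemigroupFreeProduct S) A) (n : ℕ) (l : Λ)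
    (c : (Fin (n + 1) → S l) →₀ A) :
    factorBoundary M n (c.mapDomain (Sigma.mk l)) =
      ((M.restrict (incl S l)).boundary n c).mapDomain (Sigma.mk l) := by
  induction c using Finsupp.induction_linear with
  | zero => simp
  | add f g hf hg => simp only [Finsupp.mapDomain_add, map_add, hf, hg]
  | single s a => rw [Finsupp.mapDomain_single, factorBoundary_single]

theorem factorBoundary_mapRange {M : SemigroupModule (SemigroupFreeProduct S) A}
    {M' : SemigroupModule (SemigroupFreeProduct S) A'} (φ : A →+ A')
    (hφ : ∀ a s, φ (M.act a s) = M'.act (φ a) s) (n : ℕ) (c : (Σ l, Fin (n + 1) → S l) →₀ A) :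
    factorBoundary M' n (Finsupp.mapRange.addMonoidHom φ c) =
      Finsupp.mapRange.addMonoidHom φ (factorBoundary M n c) := by
  induction c using Finsupp.induction_linear with
  | zero => simp
  | add f g hf hg => simp only [map_add, hf, hg]
  | single s a =>
    obtain ⟨l, s⟩ := s
    have h := boundary_mapRange (M := M.restrict (incl S l)) (M' := M'.restrict (incl S l)) φ
      (fun a s => hφ a _) n (Finsupp.single s a)
    rw [Finsupp.mapRange.addMonoidHom_apply, Finsupp.mapRange_single] at h
    rw [Finsupp.mapRange.addMonoidHom_apply, Finsupp.mapRange_single, factorBoundary_single,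
      factorBoundary_single, h]
    exact Finsupp.mapDomain_mapRange _ _ _ (map_zero φ) (map_add φ)

theorem factorBoundary_factorBoundary (M : SemigroupModule (SemigroupFreeProduct S) A) (n : ℕ)
    (c : (Σ l, Fin (n + 2) → S l) →₀ A) :
    factorBoundary M n (factorBoundary M (n + 1) c) = 0 := by
  induction c using Finsupp.induction_linear with
  | zero => simp
  | add f g hf hg => simp only [map_add, hf, hg, add_zero]
  | single s a =>
    rw [factorBoundary_single, factorBoundary_mapDomain, boundary_boundary, Finsupp.mapDomain_zero]

theorem splitHom_factorBoundary (M : SemigroupModule (SemigroupFreeProduct S) A) (n : ℕ) (l : Λ)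
    (c : (Σ l, Fin (n + 1) → S l) →₀ A) :
    splitHom A n l (factorBoundary M n c) =
      (M.restrict (incl S l)).boundary n (splitHom A (n + 1) l c) := by
  induction c using Finsupp.induction_linear with
  | zero => simp
  | add f g hf hg => simp only [map_add, hf, hg]
  | single s a =>
    obtain ⟨m, s⟩ := s
    rw [← Finsupp.mapDomain_single (f := Sigma.mk m), factorBoundary_mapDomain]
    by_cases h : l = m
    · subst h
      rw [splitHom_mapDomain_self, splitHom_mapDomain_self]
    · rw [splitHom_mapDomain_of_ne _ h, splitHom_mapDomain_of_ne _ h, map_zero]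

/-- The chains of the factors as chains of the free product. -/
noncomputable def factorIncl (S : Λ → Type*) [∀ l, Semigroup (S l)] (A : Type*) [AddCommGroup A]
    (n : ℕ) : ((Σ l, Fin n → S l) →₀ A) →+ ((Fin n → SemigroupFreeProduct S) →₀ A) :=
  Finsupp.mapDomain.addMonoidHom fun x => incl S x.1 ∘ x.2

theorem factorIncl_mapDomain (n : ℕ) (l : Λ) (c : (Fin n → S l) →₀ A) :
    factorIncl S A n (c.mapDomain (Sigma.mk l)) =
      c.mapDomain fun s : Fin n → S l => (incl S l ∘ s : Fin n → SemigroupFreeProduct S) :=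
  (Finsupp.mapDomain_comp (v := c) (f := fun s => (⟨l, s⟩ : Σ l, Fin n → S l))
    (g := fun x => incl S x.1 ∘ x.2)).symm

theorem boundary_factorIncl (M : SemigroupModule (SemigroupFreeProduct S) A) (n : ℕ)
    (c : (Σ l, Fin (n + 1) → S l) →₀ A) :
    M.boundary n (factorIncl S A (n + 1) c) = factorIncl S A n (factorBoundary M n c) := by
  induction c using Finsupp.induction_linear with
  | zero => simp
  | add f g hf hg => simp only [map_add, hf, hg]
  | single s a =>
    obtain ⟨m, s⟩ := s
    rw [← Finsupp.mapDomain_single (f := Sigma.mk m), factorBoundary_mapDomain,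
      factorIncl_mapDomain, factorIncl_mapDomain]
    exact boundary_mapDomain M (incl S m) n _

theorem factorIncl_mapRange (φ : A →+ A') (n : ℕ) (c : (Σ l, Fin n → S l) →₀ A) :
    factorIncl S A' n (Finsupp.mapRange.addMonoidHom φ c) =
      Finsupp.mapRange.addMonoidHom φ (factorIncl S A n c) :=
  Finsupp.mapDomain_mapRange _ _ _ (map_zero φ) (map_add φ)

end SemigroupFreeProduct

namespace SemigroupFreeProduct

open SemigroupModule

/-! ### Exactness over `ℤ[S¹]` and the homotopy equivalence. -/

section Exactness

variable {Λ : Type*} (S : Λ → Type*) [∀ l, Semigroup (S l)]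

/-- The boundary of the direct sum of the complexes of the factors, with coefficients in `ℤ[S¹]`,
as a left linear map. -/
noncomputable def linearFactorBoundary (n : ℕ) :
    ((Σ l, Fin (n + 1) → S l) →₀ UnitalRing (SemigroupFreeProduct S))
      →ₗ[UnitalRing (SemigroupFreeProduct S)]
      ((Σ l, Fin n → S l) →₀ UnitalRing (SemigroupFreeProduct S)) where
  __ := factorBoundary (regular (SemigroupFreeProduct S)) n
  map_smul' r c := by
    have h := factorBoundary_mapRange (M := regular (SemigroupFreeProduct S))
      (M' := regular (SemigroupFreeProduct S)) (AddMonoidHom.mulLeft r)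
      (fun a s => by simp [mul_assoc]) n c
    rw [mapRange_mulLeft, mapRange_mulLeft] at h
    exact h

/-- The inclusion of the direct sum of the complexes of the factors, with coefficients in
`ℤ[S¹]`, as a left linear map. -/
noncomputable def linearFactorIncl (n : ℕ) :
    ((Σ l, Fin n → S l) →₀ UnitalRing (SemigroupFreeProduct S))
      →ₗ[UnitalRing (SemigroupFreeProduct S)]
      ((Fin n → SemigroupFreeProduct S) →₀ UnitalRing (SemigroupFreeProduct S)) where
  __ := factorIncl S (UnitalRing (SemigroupFreeProduct S)) n
  map_smul' r c := by
    have h := factorIncl_mapRange (S := S) (AddMonoidHom.mulLeft r) n c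
    rw [mapRange_mulLeft, mapRange_mulLeft] at h
    exact h

theorem linearFactorBoundary_apply (n : ℕ)
    (c : (Σ l, Fin (n + 1) → S l) →₀ UnitalRing (SemigroupFreeProduct S)) :
    linearFactorBoundary S n c = factorBoundary (regular (SemigroupFreeProduct S)) n c := rfl

theorem linearFactorIncl_apply (n : ℕ)
    (c : (Σ l, Fin n → S l) →₀ UnitalRing (SemigroupFreeProduct S)) :
    linearFactorIncl S n c = factorIncl S _ n c := rfl

theorem ker_linearBoundary_le (T : Type*) [Semigroup T] (n : ℕ) :
    LinearMap.ker (linearBoundary T n) ≤ LinearMap.range (linearBoundary T (n + 1)) := by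
  intro c hc
  have h := regular_boundary_prepend n c
  rw [LinearMap.mem_ker, linearBoundary_apply] at hc
  rw [hc, map_zero, add_zero] at h
  exact ⟨_, h⟩

/-- Each component of a cycle is a cycle of its factor and bounds by the contraction along
`decompose S l`; only finitely many components are nonzero. -/
theorem ker_linearFactorBoundary_le (n : ℕ) :
    LinearMap.ker (linearFactorBoundary S n) ≤ LinearMap.range (linearFactorBoundary S (n + 1)) := by
  intro c hc
  rw [LinearMap.mem_ker, linearFactorBoundary_apply] at hc
  rw [← sum_mapDomain_splitHom _ c]
  refine Submodule.sum_mem _ fun l _ => ?_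
  have h := boundary_prepend_component (incl S l) (decompose S l) (decompose_prod S l)
    (decompose_mul S l) n (splitHom _ _ l c)
  rw [← splitHom_factorBoundary, hc, map_zero, map_zero, add_zero] at h
  refine ⟨Finsupp.mapDomain (Sigma.mk l)
    (prepend (component (decompose S l)) (n + 1) (splitHom _ _ l c)), ?_⟩
  rw [linearFactorBoundary_apply, factorBoundary_mapDomain, h]

/-- The augmentation of the direct sum of the complexes of the factors, truncated below degree
one. -/
noncomputable def augmentation :
    ((Σ l, Fin 1 → S l) →₀ UnitalRing (SemigroupFreeProduct S))
      →ₗ[UnitalRing (SemigroupFreeProduct S)]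
      ((Fin 0 → SemigroupFreeProduct S) →₀ UnitalRing (SemigroupFreeProduct S)) :=
  linearBoundary (SemigroupFreeProduct S) 0 ∘ₗ linearFactorIncl S 1

theorem linearBoundary_zero_single {T : Type*} [Semigroup T] (s : Fin 1 → T) (r : UnitalRing T) :
    linearBoundary T 0 (Finsupp.single s r) =
      Finsupp.single Fin.elim0 (r * MonoidAlgebra.of ℤ _ (s 0 : WithOne T)) -
        Finsupp.single Fin.elim0 r := by
  have h : ∀ f : Fin 0 → T, f = Fin.elim0 := fun f => Subsingleton.elim _ _
  rw [linearBoundary_apply, boundary_single]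
  simp [h, sub_eq_add_neg]

theorem augmentation_single (l : Λ) (s : Fin 1 → S l) (r : UnitalRing (SemigroupFreeProduct S)) :
    augmentation S (Finsupp.single ⟨l, s⟩ r) =
      Finsupp.single Fin.elim0 (r * MonoidAlgebra.of ℤ _
        (incl S l (s 0) : WithOne (SemigroupFreeProduct S))) - Finsupp.single Fin.elim0 r := by
  rw [augmentation, LinearMap.comp_apply, linearFactorIncl_apply, factorIncl,
    Finsupp.mapDomain.addMonoidHom_apply, Finsupp.mapDomain_single, linearBoundary_zero_single]
  rfl

theorem linearFactorBoundary_one_single (l : Λ) (s t : S l) :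
    linearFactorBoundary S 1 (Finsupp.single ⟨l, ![s, t]⟩ 1) =
      Finsupp.single ⟨l, fun _ => t⟩ (MonoidAlgebra.of ℤ _
        (incl S l s : WithOne (SemigroupFreeProduct S))) -
      Finsupp.single ⟨l, fun _ => s * t⟩ 1 + Finsupp.single ⟨l, fun _ => s⟩ 1 := by
  have h0 : Fin.contractNth 0 (· * ·) ![s, t] = fun _ : Fin 1 => s * t := by
    funext k
    fin_cases k
    rfl
  have h1 : Fin.contractNth 1 (· * ·) ![s, t] = fun _ : Fin 1 => s := by
    funext k
    fin_cases k
    rfl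
  rw [linearFactorBoundary_apply, factorBoundary_single, boundary_single, Fin.sum_univ_two]
  simp only [h0, h1, Finsupp.mapDomain_add, Finsupp.mapDomain_smul, Finsupp.mapDomain_single]
  simp [restrict, sub_eq_add_neg, add_assoc, neg_smul]

/-- A left inverse modulo boundaries is built: an additive `δ` on `ℤ[S¹]` whose composite with the
augmentation is the quotient map `q`. -/
theorem ker_augmentation_le :
    LinearMap.ker (augmentation S) ≤ LinearMap.range (linearFactorBoundary S 1) := by
  let q := (LinearMap.range (linearFactorBoundary S 1)).mkQ
  -- Since `∂[s, t] = s[t] - [st] + [s]`, the class of `[s]` modulo boundaries is a crossed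
  -- homomorphism on each factor.
  obtain ⟨D, hD, hmul⟩ := exists_crossedHom (S := S)
    (fun l s => q (Finsupp.single ⟨l, fun _ => s⟩ 1)) (by
      intro l s t
      rw [← map_smul, ← map_add, ← sub_eq_zero, ← map_sub]
      refine (Submodule.Quotient.mk_eq_zero _).2 ⟨-Finsupp.single ⟨l, ![s, t]⟩ 1, ?_⟩
      rw [map_neg, linearFactorBoundary_one_single]
      simp only [Finsupp.smul_single, smul_eq_mul, mul_one]
      abel)
  let D₁ : WithOne (SemigroupFreeProduct S) → _ := WithOne.recOneCoe (motive := fun _ => _) 0 D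
  have hD₁ : ∀ (x : WithOne (SemigroupFreeProduct S)) (l : Λ) (s : S l),
      D₁ (x * incl S l s) = D₁ x +
        MonoidAlgebra.of ℤ _ x • q (Finsupp.single ⟨l, fun _ => s⟩ 1) := by
    intro x l s
    cases x with
    | one =>
      rw [one_mul, map_one, one_smul]
      simp only [D₁, WithOne.recOneCoe_coe, WithOne.recOneCoe_one, hD, zero_add]
    | coe x =>
      rw [← WithOne.coe_mul]
      simp only [D₁, WithOne.recOneCoe_coe]
      rw [hmul, hD]
  let δ := MonoidAlgebra.extend D₁
  -- On `x[s]` the left side is `D₁(x s) - D₁(x) = x q([s])`.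
  have key : (Finsupp.liftAddHom fun _ => δ).comp (augmentation S).toAddMonoidHom =
      q.toAddMonoidHom := by
    refine Finsupp.addHom_ext' fun ⟨l, s⟩ => MonoidAlgebra.addMonoidHom_ext_of fun x => ?_
    simp only [AddMonoidHom.comp_apply, Finsupp.singleAddHom_apply, LinearMap.toAddMonoidHom_coe]
    rw [augmentation_single, map_sub, Finsupp.liftAddHom_apply_single,
      Finsupp.liftAddHom_apply_single, ← map_mul]
    simp only [δ, MonoidAlgebra.extend_of]
    rw [hD₁, add_sub_cancel_left, ← map_smul, Finsupp.smul_single, smul_eq_mul, mul_one]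
    congr
    funext i
    rw [Subsingleton.elim i 0]
  intro c hc
  rw [LinearMap.mem_ker] at hc
  have h := DFunLike.congr_fun key c
  simp only [AddMonoidHom.comp_apply, LinearMap.toAddMonoidHom_coe] at h
  rw [hc, map_zero] at h
  exact (Submodule.Quotient.mk_eq_zero _).1 h.symm

/-- By `xy - 1 = (x - 1) + x(y - 1)`, the factors already generate the left ideal spanned by all `x
- 1`. -/
theorem linearBoundary_single_mem_range_augmentation (x : SemigroupFreeProduct S) :
    linearBoundary _ 0 (Finsupp.single (fun _ => x) 1) ∈ LinearMap.range (augmentation S) := by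
  induction x using induction_on with
  | incl l s =>
    refine ⟨Finsupp.single ⟨l, fun _ => s⟩ 1, ?_⟩
    rw [augmentation_single, linearBoundary_zero_single]
  | mul x y hx hy =>
    have h : linearBoundary (SemigroupFreeProduct S) 0 (Finsupp.single (fun _ => x * y) 1) =
        linearBoundary _ 0 (Finsupp.single (fun _ => x) 1) +
          MonoidAlgebra.of ℤ _ (x : WithOne (SemigroupFreeProduct S)) •
            linearBoundary _ 0 (Finsupp.single (fun _ => y) 1) := by
      simp only [linearBoundary_zero_single, smul_sub, Finsupp.smul_single, smul_eq_mul, one_mul,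
        mul_one, WithOne.coe_mul, map_mul]
      abel
    rw [h]
    exact Submodule.add_mem _ hx (Submodule.smul_mem _ _ hy)

/-- The complex of the free product and the direct sum of the complexes of the factors are
homotopy equivalent in degrees at least two, with coefficients in `ℤ[S¹]`. -/
theorem exists_linear_homotopy_equivalence :
    ∃ (ρ : ∀ m, ((Fin (m + 1) → SemigroupFreeProduct S) →₀ UnitalRing (SemigroupFreeProduct S))
          →ₗ[UnitalRing (SemigroupFreeProduct S)]
          ((Σ l, Fin (m + 1) → S l) →₀ UnitalRing (SemigroupFreeProduct S)))
      (h : ∀ m, ((Fin (m + 1) → SemigroupFreeProduct S) →₀ UnitalRing (SemigroupFreeProduct S))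
          →ₗ[UnitalRing (SemigroupFreeProduct S)]
          ((Fin (m + 2) → SemigroupFreeProduct S) →₀ UnitalRing (SemigroupFreeProduct S)))
      (k : ∀ m, ((Σ l, Fin (m + 1) → S l) →₀ UnitalRing (SemigroupFreeProduct S))
          →ₗ[UnitalRing (SemigroupFreeProduct S)]
          ((Σ l, Fin (m + 2) → S l) →₀ UnitalRing (SemigroupFreeProduct S))),
      (∀ m, linearFactorBoundary S (m + 1) ∘ₗ ρ (m + 1) = ρ m ∘ₗ linearBoundary _ (m + 1)) ∧
      (∀ m, linearBoundary _ (m + 2) ∘ₗ h (m + 1) + h m ∘ₗ linearBoundary _ (m + 1) =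
        linearFactorIncl S (m + 2) ∘ₗ ρ (m + 1) - LinearMap.id) ∧
      ∀ m, linearFactorBoundary S (m + 2) ∘ₗ k (m + 1) + k m ∘ₗ linearFactorBoundary S (m + 1) =
        ρ (m + 1) ∘ₗ linearFactorIncl S (m + 2) - LinearMap.id := by
  have hX : ∀ m, linearBoundary (SemigroupFreeProduct S) m ∘ₗ linearBoundary _ (m + 1) = 0 :=
    fun m => LinearMap.ext fun c => boundary_boundary _ m c
  have hY : ∀ m, linearFactorBoundary S m ∘ₗ linearFactorBoundary S (m + 1) = 0 :=
    fun m => LinearMap.ext fun c => factorBoundary_factorBoundary _ m c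
  have hι : ∀ m, linearBoundary _ m ∘ₗ linearFactorIncl S (m + 1) =
      linearFactorIncl S m ∘ₗ linearFactorBoundary S m :=
    fun m => LinearMap.ext fun c => boundary_factorIncl _ m c
  -- Index `m` of `ρ`, `h` and `k` stands for degree `m + 1`. In degree one, `ρ₀` is a map over the
  -- common left ideal, so both `ι ρ₀ - 1` and `ρ₀ ι - 1` (with `ι` the inclusion) are killed by the
  -- augmentations and have values in boundaries.
  obtain ⟨ρ₀, hρ₀⟩ := Finsupp.exists_comp_eq (linearBoundary (SemigroupFreeProduct S) 0)
    (augmentation S) fun x => by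
      have hx : x = fun _ => x 0 := funext fun i => congrArg x (Fin.fin_one_eq_zero i)
      rw [hx]
      exact linearBoundary_single_mem_range_augmentation S (x 0)
  have hρ₀' : ∀ c, augmentation S (ρ₀ c) = linearBoundary _ 0 c := LinearMap.congr_fun hρ₀
  obtain ⟨ρ, rfl, hρ⟩ := exists_chainMap
    (X := fun m => Fin (m + 1) → SemigroupFreeProduct S) (Y := fun m => Σ l, Fin (m + 1) → S l)
    (fun m => linearBoundary _ (m + 1)) (fun m => linearFactorBoundary S (m + 1))
    (fun m => hX (m + 1)) (fun m => ker_linearFactorBoundary_le S (m + 1)) ρ₀ (fun c => by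
      refine ker_augmentation_le S ?_
      rw [LinearMap.mem_ker, hρ₀']
      exact LinearMap.congr_fun (hX 0) c)
  obtain ⟨h, hh⟩ := exists_nullHomotopy
    (X := fun m => Fin (m + 1) → SemigroupFreeProduct S)
    (Y := fun m => Fin (m + 1) → SemigroupFreeProduct S)
    (fun m => linearBoundary (SemigroupFreeProduct S) (m + 1)) (fun m => linearBoundary (SemigroupFreeProduct S) (m + 1))
    (fun m => hX (m + 1)) (fun m => ker_linearBoundary_le (SemigroupFreeProduct S) (m + 1))
    (fun m => linearFactorIncl S (m + 1) ∘ₗ ρ m - LinearMap.id)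
    (fun m => by
      rw [LinearMap.comp_sub, ← LinearMap.comp_assoc, hι, LinearMap.comp_assoc, hρ,
        LinearMap.sub_comp, LinearMap.comp_id, LinearMap.id_comp, LinearMap.comp_assoc])
    (fun c => by
      refine ker_linearBoundary_le (SemigroupFreeProduct S) 0 ?_
      rw [LinearMap.mem_ker, LinearMap.sub_apply, map_sub]
      exact sub_eq_zero.2 (hρ₀' c))
  obtain ⟨k, hk⟩ := exists_nullHomotopy
    (X := fun m => Σ l, Fin (m + 1) → S l) (Y := fun m => Σ l, Fin (m + 1) → S l)
    (fun m => linearFactorBoundary S (m + 1)) (fun m => linearFactorBoundary S (m + 1))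
    (fun m => hY (m + 1)) (fun m => ker_linearFactorBoundary_le S (m + 1))
    (fun m => ρ m ∘ₗ linearFactorIncl S (m + 1) - LinearMap.id)
    (fun m => by
      rw [LinearMap.comp_sub, ← LinearMap.comp_assoc, hρ, LinearMap.comp_assoc, hι,
        LinearMap.sub_comp, LinearMap.comp_id, LinearMap.id_comp, LinearMap.comp_assoc])
    (fun c => by
      refine ker_augmentation_le S ?_
      rw [LinearMap.mem_ker, LinearMap.sub_apply, map_sub]
      exact sub_eq_zero.2 (hρ₀' _))
  exact ⟨ρ, h, k, hρ, hh, hk⟩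

end Exactness

end SemigroupFreeProduct

/-! ### Passage to coefficients `A` and to homology. -/

namespace SemigroupFreeProduct

open SemigroupModule

variable {Λ : Type*} {S : Λ → Type*} [∀ l, Semigroup (S l)] {A : Type*} [AddCommGroup A]

theorem baseChange_linearBoundary (M : SemigroupModule (SemigroupFreeProduct S) A) (n : ℕ) :
    M.baseChange (linearBoundary _ n) = M.boundary n :=
  baseChange_eq _ _ _ fun a c => boundary_mapRange (M.orbit a) (M.orbit_act a) n c

theorem baseChange_linearFactorBoundary (M : SemigroupModule (SemigroupFreeProduct S) A) (n : ℕ) :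
    M.baseChange (linearFactorBoundary S n) = factorBoundary M n :=
  baseChange_eq _ _ _ fun a c => factorBoundary_mapRange (M.orbit a) (M.orbit_act a) n c

theorem baseChange_linearFactorIncl (M : SemigroupModule (SemigroupFreeProduct S) A) (n : ℕ) :
    M.baseChange (linearFactorIncl S n) = factorIncl S A n :=
  baseChange_eq _ _ _ fun a c => factorIncl_mapRange (M.orbit a) n c

/-- In degrees at least two, the complex of the free product is homotopy equivalent to the direct
sum of the complexes of the factors. -/
theorem exists_homotopy_equivalence (M : SemigroupModule (SemigroupFreeProduct S) A) :
    ∃ (ρ : ∀ m, ((Fin (m + 1) → SemigroupFreeProduct S) →₀ A) →+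
          ((Σ l, Fin (m + 1) → S l) →₀ A))
      (h : ∀ m, ((Fin (m + 1) → SemigroupFreeProduct S) →₀ A) →+
          ((Fin (m + 2) → SemigroupFreeProduct S) →₀ A))
      (k : ∀ m, ((Σ l, Fin (m + 1) → S l) →₀ A) →+ ((Σ l, Fin (m + 2) → S l) →₀ A)),
      (∀ m c, factorBoundary M (m + 1) (ρ (m + 1) c) = ρ m (M.boundary (m + 1) c)) ∧
      (∀ m c, M.boundary (m + 2) (h (m + 1) c) + h m (M.boundary (m + 1) c) =
        factorIncl S A (m + 2) (ρ (m + 1) c) - c) ∧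
      ∀ m c, factorBoundary M (m + 2) (k (m + 1) c) + k m (factorBoundary M (m + 1) c) =
        ρ (m + 1) (factorIncl S A (m + 2) c) - c := by
  obtain ⟨ρ, h, k, hρ, hh, hk⟩ := exists_linear_homotopy_equivalence S
  refine ⟨fun m => M.baseChange (ρ m), fun m => M.baseChange (h m), fun m => M.baseChange (k m),
    fun m c => ?_, fun m c => ?_, fun m c => ?_⟩
  · have := congrArg M.baseChange (hρ m)
    simp only [baseChange_comp, baseChange_linearBoundary, baseChange_linearFactorBoundary] at this
    exact DFunLike.congr_fun this c
  · have := congrArg M.baseChange (hh m)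
    simp only [baseChange_add, baseChange_sub, baseChange_comp, baseChange_linearBoundary,
      baseChange_linearFactorIncl, baseChange_id] at this
    exact DFunLike.congr_fun this c
  · have := congrArg M.baseChange (hk m)
    simp only [baseChange_add, baseChange_sub, baseChange_comp, baseChange_linearFactorBoundary,
      baseChange_linearFactorIncl, baseChange_id] at this
    exact DFunLike.congr_fun this c

section Homology

variable (M : SemigroupModule (SemigroupFreeProduct S) A) (n : ℕ)

/-- The cycles of a factor as cycles of the free product. -/
noncomputable def cyclesMap (l : Λ) :
    (M.restrict (incl S l)).cycles (n + 1) →+ M.cycles (n + 1) :=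
  ((Finsupp.mapDomain.addMonoidHom fun s : Fin (n + 1) → S l =>
    (incl S l ∘ s : Fin (n + 1) → SemigroupFreeProduct S)).comp
      (AddSubgroup.subtype _)).codRestrict _ fun c => by
    change M.boundary n (Finsupp.mapDomain _ c.1) = 0
    rw [boundary_mapDomain, (c.2 : (M.restrict (incl S l)).boundary n c.1 = 0),
      Finsupp.mapDomain_zero]

/-- The map in homology induced by the inclusion of a factor in the free product. -/
noncomputable def homologyMap (l : Λ) :
    (M.restrict (incl S l)).Homology (n + 1) →+ M.Homology (n + 1) :=
  QuotientAddGroup.map _ _ (cyclesMap M n l) fun c hc => by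
    obtain ⟨b, hb⟩ := hc
    refine ⟨Finsupp.mapDomain (fun s => incl S l ∘ s) b, ?_⟩
    rw [boundary_mapDomain, hb]
    rfl

open Classical in
/-- The map from the direct sum of the homology groups of the factors to the homology of the free
product. -/
noncomputable def sumHomologyMap :
    (DirectSum Λ fun l => (M.restrict (incl S l)).Homology (n + 1)) →+ M.Homology (n + 1) :=
  DirectSum.toAddMonoid (homologyMap M n)

/-- The component in a factor of a cycle of the direct sum. -/
noncomputable def splitCycles (l : Λ) :
    (factorBoundary M n).ker →+ (M.restrict (incl S l)).cycles (n + 1) :=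
  ((splitHom A (n + 1) l).comp (AddSubgroup.subtype _)).codRestrict _ fun c => by
    change (M.restrict (incl S l)).boundary n (splitHom A (n + 1) l c.1) = 0
    rw [← splitHom_factorBoundary, (c.2 : factorBoundary M n c.1 = 0), map_zero]

/-- The cycles of the direct sum as cycles of the free product. -/
noncomputable def factorCyclesMap : (factorBoundary M n).ker →+ M.cycles (n + 1) :=
  ((factorIncl S A (n + 1)).comp (AddSubgroup.subtype _)).codRestrict _ fun c => by
    change M.boundary n (factorIncl S A (n + 1) c.1) = 0
    rw [boundary_factorIncl, (c.2 : factorBoundary M n c.1 = 0), map_zero]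

/-- One cycle of the direct sum complex represents all components of `x` at once, so the homology of
that complex need not be introduced. -/
theorem exists_factor_cycle (x : DirectSum Λ fun l => (M.restrict (incl S l)).Homology (n + 1)) :
    ∃ e : (factorBoundary M n).ker,
      sumHomologyMap M n x = QuotientAddGroup.mk (factorCyclesMap M n e) ∧
        ∀ l, x l = QuotientAddGroup.mk (splitCycles M n l e) := by
  classical
  induction x using DirectSum.induction_on with
  | zero => exact ⟨0, by simp, fun l => by simp⟩
  | of l q =>
    induction q using QuotientAddGroup.induction_on with
    | H z =>
      have hz : (M.restrict (incl S l)).boundary n z.1 = 0 := z.2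
      refine ⟨⟨z.1.mapDomain (Sigma.mk l), ?_⟩, ?_, fun m => ?_⟩
      · rw [AddMonoidHom.mem_ker, factorBoundary_mapDomain, hz, Finsupp.mapDomain_zero]
      · rw [sumHomologyMap, DirectSum.toAddMonoid_of]
        refine congrArg QuotientAddGroup.mk (Subtype.ext ?_)
        exact (factorIncl_mapDomain (n + 1) l z.1).symm
      · by_cases h : m = l
        · subst h
          rw [DirectSum.of_eq_same]
          refine congrArg QuotientAddGroup.mk (Subtype.ext ?_)
          exact (splitHom_mapDomain_self (n + 1) m z.1).symm
        · rw [DirectSum.of_eq_of_ne _ _ _ h, eq_comm, QuotientAddGroup.eq_zero_iff]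
          refine ⟨0, ?_⟩
          rw [map_zero]
          exact (splitHom_mapDomain_of_ne (n + 1) h z.1).symm
  | add x y hx hy =>
    obtain ⟨e, he, he'⟩ := hx
    obtain ⟨f, hf, hf'⟩ := hy
    refine ⟨e + f, ?_, fun l => ?_⟩
    · rw [map_add, he, hf, map_add, QuotientAddGroup.mk_add]
    · rw [DirectSum.add_apply, he', hf', map_add, QuotientAddGroup.mk_add]

theorem mk_factorCyclesMap_mem_range (e : (factorBoundary M n).ker) :
    (QuotientAddGroup.mk (factorCyclesMap M n e) : M.Homology (n + 1)) ∈
      (sumHomologyMap M n).range := by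
  classical
  have h : factorCyclesMap M n e =
      ∑ l ∈ e.1.splitSupport, cyclesMap M n l (splitCycles M n l e) := by
    refine Subtype.ext ?_
    rw [AddSubgroup.val_finsetSum]
    change factorIncl S A (n + 1) e.1 = _
    conv_lhs => rw [← sum_mapDomain_splitHom (n + 1) e.1, map_sum]
    exact Finset.sum_congr rfl fun l _ => factorIncl_mapDomain _ _ _
  rw [h, ← QuotientAddGroup.mk'_apply, map_sum]
  refine AddSubgroup.sum_mem _ fun l _ =>
    ⟨DirectSum.of (fun l => (M.restrict (incl S l)).Homology (n + 1)) l
      (QuotientAddGroup.mk (splitCycles M n l e)), ?_⟩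
  rw [sumHomologyMap, DirectSum.toAddMonoid_of]
  rfl

theorem sumHomologyMap_bijective (m : ℕ) : Function.Bijective (sumHomologyMap M (m + 1)) := by
  obtain ⟨ρ, h, k, hρ, hh, hk⟩ := exists_homotopy_equivalence M
  refine ⟨(injective_iff_map_eq_zero _).2 fun x hx => ?_, fun q => ?_⟩
  · obtain ⟨e, he, hxe⟩ := exists_factor_cycle M (m + 1) x
    rw [he, QuotientAddGroup.eq_zero_iff] at hx
    obtain ⟨w, hw⟩ := hx
    replace hw : M.boundary (m + 2) w = factorIncl S A (m + 2) e.1 := hw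
    -- If `∂w = ι e`, then `∂ρw = ρ ι e`, while `∂ke = ρ ι e - e` because `e` is a cycle.
    have hb : factorBoundary M (m + 2) (ρ (m + 2) w - k (m + 1) e.1) = e.1 := by
      have h1 := hk m e.1
      rw [(e.2 : factorBoundary M (m + 1) e.1 = 0), map_zero, add_zero] at h1
      rw [map_sub, hρ, hw, h1, sub_sub_cancel]
    refine DFinsupp.ext fun l => ?_
    refine (hxe l).trans ((QuotientAddGroup.eq_zero_iff _).2 ?_)
    refine ⟨splitHom A (m + 3) l (ρ (m + 2) w - k (m + 1) e.1), ?_⟩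
    rw [← splitHom_factorBoundary, hb]
    rfl
  · induction q using QuotientAddGroup.induction_on with
    | H z =>
      have hz : M.boundary (m + 1) z.1 = 0 := z.2
      have he : factorBoundary M (m + 1) (ρ (m + 1) z.1) = 0 := by rw [hρ, hz, map_zero]
      obtain ⟨x, hx⟩ := mk_factorCyclesMap_mem_range M (m + 1) ⟨_, he⟩
      -- For a cycle `z` the homotopy gives `∂hz = ι ρ z - z`, so `ρ z` represents a preimage.
      refine ⟨x, hx.trans (QuotientAddGroup.eq_iff_sub_mem.2 ⟨h (m + 1) z.1, ?_⟩)⟩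
      have h1 := hh m z.1
      rw [hz, map_zero, add_zero] at h1
      exact h1

end Homology

end SemigroupFreeProduct

theorem mainTheorem2 {Λ : Type*} (S : Λ → Type*) [∀ l, Semigroup (S l)]
    {A : Type*} [AddCommGroup A] (M : SemigroupModule (SemigroupFreeProduct S) A)
    (n : ℕ) (hn : 1 < n) :
    Nonempty (M.Homology n ≃+
      DirectSum Λ fun l => (M.restrict (SemigroupFreeProduct.incl S l)).Homology n) := by
  -- Here `n = m + 2`, whereas `sumHomologyMap M (m + 1)` already carries a shift by one.
  obtain ⟨m, rfl⟩ := Nat.exists_eq_add_of_le' hn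
  exact ⟨(AddEquiv.ofBijective _ (SemigroupFreeProduct.sumHomologyMap_bijective M m)).symm⟩
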